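/- A polynomial endomorphism of the complex affine plane is a pair $f=(f_1,f_2)$ with $f_1,f_2\in\mathbb C[X,Y]$; its degree is $\deg f=\max(\deg f_1,\deg f_2)$. Let $\mathcal G$ be the group (under composition) of polynomial automorphisms of $\mathbb A^2_{\mathbb C}$, that is, of the endomorphisms which have a polynomial inverse. For $m\in\mathbb N$ let $\mathcal E_{\le m}$ be the finite-dimensional complex affine space of polynomial endomorphisms of degree at most $m$, with its Zariski topology (closed sets are the zero loci of sets of polynomials in the coefficients). For $f\in\mathcal G$ let $\mathcal C(f)\subseteq\mathcal G$ be its conjugacy class in $\mathcal G$, and put $\mathcal C(f)_{\le m}=\mathcal C(f)\cap\mathcal E_{\le m}$. Lemma 3.2. Let $a,b\in\mathbb C^*$, let $f=(aX,bY)\in\mathcal G$, let $m\in\mathbb N$ and let $\alpha,\beta\in\mathbb C$ with $\alpha\ne1$ and $\beta\ne1$. If $(\alpha X,\beta Y)$ lies in the closure $\overline{\mathcal C(f)_{\le m}}$ of $\mathcal C(f)_{\le m}$ in $\mathcal E_{\le m}$, then $\{\alpha,\beta\}=\{a,b\}$. -/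

import Mathlib

noncomputable section

/-- A polynomial endomorphism `(f₁, f₂)` of the complex affine plane, given by its two coordinate
functions in `ℂ[X, Y]`; the variables are `X = MvPolynomial.X 0` and `Y = MvPolynomial.X 1`. -/
@[ext]
structure PlaneEnd where
  /-- The coordinate functions. -/
  coord : Fin 2 → MvPolynomial (Fin 2) ℂ

namespace PlaneEnd

/-- Polynomial endomorphisms form a monoid under composition: the coordinates of `f * g = f ∘ g`
are `fᵢ(g₁, g₂)`, and the unit is `(X, Y)`. -/
instance : Monoid PlaneEnd where
  mul f g := ⟨fun i => MvPolynomial.bind₁ g.coord (f.coord i)⟩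
  one := ⟨MvPolynomial.X⟩
  mul_assoc f g h := by
    refine PlaneEnd.ext (funext fun i => ?_)
    exact MvPolynomial.bind₁_bind₁ g.coord h.coord (f.coord i)
  one_mul f := by
    refine PlaneEnd.ext (funext fun i => ?_)
    exact MvPolynomial.bind₁_X_right f.coord i
  mul_one f := by
    refine PlaneEnd.ext (funext fun i => ?_)
    exact MvPolynomial.aeval_X_left_apply (f.coord i)

/-- The diagonal endomorphism `(a X, b Y)`. -/
def diag (a b : ℂ) : PlaneEnd :=
  ⟨![MvPolynomial.C a * MvPolynomial.X 0, MvPolynomial.C b * MvPolynomial.X 1]⟩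

/-- The degree of an endomorphism: the maximum of the degrees of its two coordinates. -/
def degree (f : PlaneEnd) : ℕ :=
  max (f.coord 0).totalDegree (f.coord 1).totalDegree

end PlaneEnd

/-- The group of polynomial automorphisms of the complex affine plane: the invertible elements of
the monoid of polynomial endomorphisms. -/
abbrev PlaneAut : Type := PlaneEndˣ

/-- The space of polynomial endomorphisms of degree at most `m`. -/
def PlaneEndLE (m : ℕ) : Type := {f : PlaneEnd // f.degree ≤ m}

namespace PlaneEndLE

/-- The coefficients of an endomorphism: `f.coeffs (i, s)` is the coefficient of the monomial with
exponent `s` in the `i`-th coordinate. Those with `s` of degree at most `m` are the affine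
coordinates of the space `PlaneEndLE m`, and the others are zero on it. -/
def coeffs {m : ℕ} (f : PlaneEndLE m) : Fin 2 × (Fin 2 →₀ ℕ) → ℂ :=
  fun p => (f.1.coord p.1).coeff p.2

/-- The zero locus in `PlaneEndLE m` of a set of polynomial functions of the coefficients. -/
def zeroLocus (m : ℕ) (S : Set (MvPolynomial (Fin 2 × (Fin 2 →₀ ℕ)) ℂ)) : Set (PlaneEndLE m) :=
  {f | ∀ P ∈ S, MvPolynomial.eval f.coeffs P = 0}

/-- The Zariski topology of the affine space `PlaneEndLE m`: the closed sets are the zero loci of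
sets of polynomial functions of the coefficients. -/
instance (m : ℕ) : TopologicalSpace (PlaneEndLE m) :=
  TopologicalSpace.ofClosed (Set.range (zeroLocus m))
    ⟨{1}, by ext f; simp [zeroLocus]⟩
    (by
      intro A hA
      refine ⟨{P | ∃ S, zeroLocus m S ∈ A ∧ P ∈ S}, ?_⟩
      ext f
      simp only [zeroLocus, Set.mem_ofPred_eq, Set.mem_sInter]
      constructor
      · intro h t ht
        obtain ⟨S, rfl⟩ := hA ht
        exact fun P hP => h P ⟨S, ht, hP⟩
      · rintro h P ⟨S, hS, hP⟩
        exact h _ hS P hP)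
    (by
      rintro _ ⟨S, rfl⟩ _ ⟨T, rfl⟩
      refine ⟨{R | ∃ P ∈ S, ∃ Q ∈ T, R = P * Q}, ?_⟩
      ext f
      simp only [zeroLocus, Set.mem_ofPred_eq, Set.mem_union]
      constructor
      · intro h
        by_contra! hc
        obtain ⟨⟨P, hP, hP0⟩, Q, hQ, hQ0⟩ := hc
        have := h _ ⟨P, hP, Q, hQ, rfl⟩
        rw [map_mul] at this
        exact (mul_ne_zero hP0 hQ0) this
      · rintro h _ ⟨P, hP, Q, hQ, rfl⟩
        rw [map_mul]
        rcases h with h | h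
        · rw [h P hP, zero_mul]
        · rw [h Q hQ, mul_zero])

end PlaneEndLE

/-- The elements of degree at most `m` of the conjugacy class of `f` in the group of polynomial
automorphisms, as a subset of the space of endomorphisms of degree at most `m`. -/
def conjClassLE (f : PlaneAut) (m : ℕ) : Set (PlaneEndLE m) :=
  {g | ∃ h ∈ conjugatesOf f, (h : PlaneEnd) = g.1}

end

/-! The Jacobian matrix of `diag a b` is constant, so by the chain rule every fixed point of a
conjugate has Jacobian matrix similar to `diag(a, b)` (`det_sub_jacobianAt_of_conj`). The origin is
a fixed point of `diag α β`, nondegenerate because `α ≠ 1` and `β ≠ 1`. Nondegenerate fixed points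
form a smooth scheme over the space of coefficients, and smooth morphisms are open, so such points
persist on a Zariski neighbourhood (`exists_nhds_forall_exists_zero`). If the characteristic
polynomials of `diag(α, β)` and `diag(a, b)` differed at some `c`, the same would hold at a fixed
point of every nearby endomorphism. Some of these are conjugates of `diag a b`, a contradiction. The
nearby fixed points may live in an extension ring `L` of `ℂ`, since the chain rule works over any
`ℂ`-algebra. -/

noncomputable section

/-! ### Persistence of nondegenerate zeros -/

section FixedPoints

open MvPolynomial

universe u

/-- The Jacobian matrix of a family of polynomials. -/
def jacobianMatrix {R σ : Type*} [CommRing R] (F : σ → MvPolynomial σ R) :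
    Matrix σ σ (MvPolynomial σ R) :=
  Matrix.of fun i j => pderiv j (F i)

variable {R σ : Type u} [CommRing R]

/-- The equations of the scheme of zeros of `F` at which `Q` does not vanish; the extra variable stands for
the inverse of `Q`. -/
def awayRelation (F : σ → MvPolynomial σ R) (Q : MvPolynomial σ R) :
    σ ⊕ Unit → MvPolynomial (σ ⊕ Unit) R :=
  Sum.elim (fun i => rename Sum.inl (F i)) fun _ => rename Sum.inl Q * X (Sum.inr ()) - 1

/-- The coordinate ring of the scheme of zeros of `F` at which `Q` does not vanish. -/
abbrev AwayRing (F : σ → MvPolynomial σ R) (Q : MvPolynomial σ R) : Type u :=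
  MvPolynomial (σ ⊕ Unit) R ⧸ Ideal.span (Set.range (awayRelation F Q))

/-- The presentation of `AwayRing F Q` by the defining equations. -/
def awayPresentation (F : σ → MvPolynomial σ R) (Q : MvPolynomial σ R) :
    Algebra.PreSubmersivePresentation R (AwayRing F Q) (σ ⊕ Unit) (σ ⊕ Unit) where
  __ := Algebra.Presentation.naive
  map := id
  map_inj := Function.injective_id

lemma pderiv_inr_rename_inl (p : MvPolynomial σ R) (u : Unit) :
    pderiv (Sum.inr u) (rename (Sum.inl : σ → σ ⊕ Unit) p) = 0 := by
  induction p using MvPolynomial.induction_on with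
  | C a => simp
  | add p q hp hq => simp [hp, hq]
  | mul_X p n hp => simp [hp]

lemma mk_rename_mul_mk_X (F : σ → MvPolynomial σ R) (Q : MvPolynomial σ R) :
    (Ideal.Quotient.mk _ (rename Sum.inl Q) * Ideal.Quotient.mk _ (X (Sum.inr ())) :
      AwayRing F Q) = 1 := by
  rw [← map_mul, ← map_one (Ideal.Quotient.mk _), Ideal.Quotient.eq]
  exact Ideal.subset_span ⟨Sum.inr (), rfl⟩

lemma mk_rename_relation (F : σ → MvPolynomial σ R) (Q : MvPolynomial σ R) (i : σ) :
    (Ideal.Quotient.mk _ (rename Sum.inl (F i)) : AwayRing F Q) = 0 :=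
  Ideal.Quotient.eq_zero_iff_mem.2 (Ideal.subset_span ⟨Sum.inl i, rfl⟩)

variable [Fintype σ] [DecidableEq σ]

/-- The equations `F` do not involve the extra variable, so the matrix is block triangular; the
derivative of `Q * t - 1` in `t` is `Q`. -/
lemma det_jacobiMatrix_awayPresentation (F : σ → MvPolynomial σ R) (Q : MvPolynomial σ R) :
    (awayPresentation F Q).jacobiMatrix.det =
      rename Sum.inl (jacobianMatrix F).det * rename Sum.inl Q := by
  have key : (awayPresentation F Q).jacobiMatrix = Matrix.fromBlocks
      ((rename (Sum.inl : σ → σ ⊕ Unit)).mapMatrix (jacobianMatrix F)).transpose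
      (Matrix.of fun i _ => pderiv (Sum.inl i) (awayRelation F Q (Sum.inr ())))
      0 (Matrix.of fun _ _ => rename Sum.inl Q) := by
    refine Matrix.ext fun i j => ?_
    rw [Algebra.PreSubmersivePresentation.jacobiMatrix_apply]
    change pderiv i (awayRelation F Q j) = _
    rcases i with i | ⟨⟩ <;> rcases j with j | ⟨⟩
    · simp [awayRelation, jacobianMatrix, pderiv_rename Sum.inl_injective]
    · rfl
    · simp [awayRelation, pderiv_inr_rename_inl]
    · simp [awayRelation, pderiv_inr_rename_inl, pderiv_X]
  refine (congrArg Matrix.det key).trans ?_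
  rw [Matrix.det_fromBlocks_zero₂₁, Matrix.det_transpose, ← AlgHom.map_det]
  simp

/-- Jacobian criterion: `Q` is a unit in the quotient, hence so is its divisor, the Jacobian
determinant of `F`. -/
lemma smooth_awayRing (F : σ → MvPolynomial σ R) (Q : MvPolynomial σ R)
    (hQ : (jacobianMatrix F).det ∣ Q) : Algebra.Smooth R (AwayRing F Q) := by
  let P : Algebra.SubmersivePresentation R (AwayRing F Q) (σ ⊕ Unit) (σ ⊕ Unit) :=
    { awayPresentation F Q with
      jacobian_isUnit := by
        have hQu : IsUnit (Ideal.Quotient.mk _ (rename Sum.inl Q) : AwayRing F Q) :=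
          IsUnit.of_mul_eq_one _ (mk_rename_mul_mk_X F Q)
        have hJu := isUnit_of_dvd_unit
          (map_dvd (Ideal.Quotient.mk (Ideal.span (Set.range (awayRelation F Q))))
            (map_dvd (rename (Sum.inl : σ → σ ⊕ Unit)) hQ)) hQu
        change IsUnit (awayPresentation F Q).jacobian
        rw [Algebra.PreSubmersivePresentation.jacobian_eq_jacobiMatrix_det,
          det_jacobiMatrix_awayPresentation, map_mul]
        exact hJu.mul hQu }
  have := P.isStandardSmooth
  infer_instance

/-- Nondegenerate zeros persist under small deformations: if a system of as many polynomial
equations as unknowns over `R` has, over the point `φ` of `Spec R`, a solution at which a multiple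
`Q` of the Jacobian determinant does not vanish, then it has such a solution over all closed points
of a Zariski neighbourhood of `φ`. -/
theorem exists_nhds_forall_exists_zero {K : Type*} [Field K] (F : σ → MvPolynomial σ R)
    (Q : MvPolynomial σ R) (hQ : (jacobianMatrix F).det ∣ Q) (φ : R →+* K) (x : σ → K)
    (hF : ∀ i, eval₂ φ x (F i) = 0) (hx : eval₂ φ x Q ≠ 0) :
    ∃ P : R, φ P ≠ 0 ∧ ∀ {k : Type u} [Field k] (ψ : R →+* k), Function.Surjective ψ → ψ P ≠ 0 →
      ∃ (L : Type u) (_ : CommRing L) (_ : Algebra k L) (y : σ → L),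
        (∀ i, eval₂ ((algebraMap k L).comp ψ) y (F i) = 0) ∧
          eval₂ ((algebraMap k L).comp ψ) y Q ≠ 0 := by
  have := smooth_awayRing F Q hQ
  -- Smooth algebras are flat, so going-down holds; with finite presentation this makes the map on
  -- spectra open.
  have hopen := PrimeSpectrum.isOpenMap_comap_of_hasGoingDown_of_finitePresentation
    (R := R) (S := AwayRing F Q)
  let e : MvPolynomial (σ ⊕ Unit) R →+* K := eval₂Hom φ (Sum.elim x fun _ => (eval₂ φ x Q)⁻¹)
  have he (p : MvPolynomial σ R) : e (rename Sum.inl p) = eval₂ φ x p := by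
    simp [e, eval₂_rename]
  have hker : Ideal.span (Set.range (awayRelation F Q)) ≤ RingHom.ker e := by
    rw [Ideal.span_le]
    rintro _ ⟨i | i, rfl⟩
    · exact (he (F i)).trans (hF i)
    · have : e (X (Sum.inr ())) = (eval₂ φ x Q)⁻¹ := by simp [e]
      change e (rename Sum.inl Q * X (Sum.inr ()) - 1) = 0
      rw [map_sub, map_mul, he, this, map_one, mul_inv_cancel₀ hx, sub_self]
  let Φ : AwayRing F Q →+* K := Ideal.Quotient.lift _ e hker
  have hΦ : Φ.comp (algebraMap R (AwayRing F Q)) = φ := by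
    ext r
    exact eval₂_C φ _ r
  have hmem : PrimeSpectrum.comap φ ⊥ ∈ Set.range (PrimeSpectrum.comap
      (algebraMap R (AwayRing F Q))) :=
    ⟨PrimeSpectrum.comap Φ ⊥, by rw [← PrimeSpectrum.comap_comp_apply, hΦ]⟩
  obtain ⟨_, ⟨_, ⟨P, rfl⟩, rfl⟩, hP, hPsub⟩ := PrimeSpectrum.isBasis_basic_opens.exists_subset_of_mem_open
    hmem hopen.isOpen_range
  refine ⟨P, by simpa [PrimeSpectrum.mem_basicOpen] using hP, fun {k} _ ψ hψ hψP => ?_⟩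
  -- A prime `q` over `ker ψ` gives the solution ring `AwayRing F Q ⧸ q`. It is a `k`-algebra
  -- because `ψ` is surjective, and nonzero because `q` is prime.
  obtain ⟨q, hq⟩ := hPsub (a := PrimeSpectrum.comap ψ ⊥)
    (by simpa [PrimeSpectrum.mem_basicOpen] using hψP)
  let f : R →+* AwayRing F Q ⧸ q.asIdeal :=
    (Ideal.Quotient.mk q.asIdeal).comp (algebraMap R (AwayRing F Q))
  have hfker : RingHom.ker ψ ≤ RingHom.ker f := by
    intro r hr
    have : r ∈ (PrimeSpectrum.comap (algebraMap R (AwayRing F Q)) q).asIdeal := by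
      rw [hq]
      exact hr
    exact Ideal.Quotient.eq_zero_iff_mem.2 this
  let y (i : σ) : AwayRing F Q ⧸ q.asIdeal :=
    Ideal.Quotient.mk _ (Ideal.Quotient.mk _ (X (Sum.inl i)))
  have hy (p : MvPolynomial σ R) : eval₂ f y p =
      Ideal.Quotient.mk q.asIdeal (Ideal.Quotient.mk _ (rename Sum.inl p)) := by
    have : eval₂Hom f y = ((Ideal.Quotient.mk q.asIdeal).comp (Ideal.Quotient.mk _)).comp
        (rename Sum.inl : MvPolynomial σ R →ₐ[R] MvPolynomial (σ ⊕ Unit) R).toRingHom := by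
      ext r
      · simp [f]
        rfl
      · simp [y]
    exact congrArg (fun g => g p) this
  refine ⟨AwayRing F Q ⧸ q.asIdeal, inferInstance,
    (RingHom.liftOfSurjective ψ hψ ⟨f, hfker⟩).toAlgebra, y, ?_⟩
  rw [RingHom.algebraMap_toAlgebra, RingHom.liftOfRightInverse_comp]
  refine ⟨fun i => ?_, fun h0 => ?_⟩
  · exact (hy _).trans ((congrArg _ (mk_rename_relation F Q i)).trans (map_zero _))
  · have h1 := congrArg (Ideal.Quotient.mk q.asIdeal) (mk_rename_mul_mk_X F Q)
    rw [map_mul, ← hy, map_one] at h1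
    change eval₂ f y Q = 0 at h0
    rw [h0, zero_mul] at h1
    exact zero_ne_one h1

end FixedPoints

/-! ### Jacobian matrices at fixed points of conjugates -/

section ChainRule

open MvPolynomial

/-- The chain rule for polynomials. -/
lemma pderiv_bind₁ {R σ τ : Type*} [CommRing R] [Fintype σ] (g : σ → MvPolynomial τ R)
    (p : MvPolynomial σ R) (j : τ) :
    pderiv j (bind₁ g p) = ∑ k, bind₁ g (pderiv k p) * pderiv j (g k) := by
  classical
  induction p using MvPolynomial.induction_on with
  | C a => simp
  | add p q hp hq => simp [hp, hq, add_mul, Finset.sum_add_distrib]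
  | mul_X p n hp =>
    simp only [map_mul, bind₁_X_right, Derivation.leibniz, hp, smul_eq_mul, pderiv_X, map_add,
      add_mul, Finset.sum_add_distrib, Finset.mul_sum]
    congr 1
    · rw [Finset.sum_eq_single n]
      · simp
      · intro k _ hk
        simp [hk]
      · simp
    · exact Finset.sum_congr rfl fun k _ => by ring

variable {L : Type*} [CommRing L] [Algebra ℂ L]

/-- The Jacobian matrix of a plane endomorphism at a point. -/
def PlaneEnd.jacobianAt (g : PlaneEnd) (x : Fin 2 → L) : Matrix (Fin 2) (Fin 2) L :=
  (jacobianMatrix g.coord).map (aeval x)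

/-- The image of a point under a plane endomorphism. -/
def PlaneEnd.evalAt (g : PlaneEnd) (x : Fin 2 → L) : Fin 2 → L :=
  fun i => aeval x (g.coord i)

namespace PlaneEnd

lemma aeval_bind₁_coord (h : PlaneEnd) (x : Fin 2 → L) (p : MvPolynomial (Fin 2) ℂ) :
    aeval x (bind₁ h.coord p) = aeval (h.evalAt x) p := by
  rw [aeval_bind₁]
  rfl

lemma jacobianAt_mul (g h : PlaneEnd) (x : Fin 2 → L) :
    (g * h).jacobianAt x = g.jacobianAt (h.evalAt x) * h.jacobianAt x := by
  refine Matrix.ext fun i j => ?_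
  change aeval x (pderiv j (bind₁ h.coord (g.coord i))) = _
  rw [pderiv_bind₁, map_sum, Matrix.mul_apply]
  refine Finset.sum_congr rfl fun k _ => ?_
  rw [map_mul, aeval_bind₁_coord]
  rfl

lemma jacobianAt_one (x : Fin 2 → L) : (1 : PlaneEnd).jacobianAt x = 1 := by
  refine Matrix.ext fun i j => ?_
  change aeval x (pderiv j (X i)) = _
  rw [pderiv_X, Matrix.one_apply]
  by_cases h : i = j <;> simp [h]

lemma jacobianAt_diag (a b : ℂ) (x : Fin 2 → L) :
    (diag a b).jacobianAt x = Matrix.diagonal ![algebraMap ℂ L a, algebraMap ℂ L b] := by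
  refine Matrix.ext fun i j => ?_
  change aeval x (pderiv j ((diag a b).coord i)) = _
  fin_cases i <;> fin_cases j <;> simp [diag, pderiv_X]

/-- At every fixed point of a conjugate of `(a X, b Y)`, the Jacobian matrix has the same
characteristic polynomial as `diag(a, b)`. -/
lemma det_sub_jacobianAt_of_conj {a b : ℂ} {f : PlaneAut} (hf : (f : PlaneEnd) = diag a b)
    {g : PlaneAut} (hg : g ∈ conjugatesOf f) {x : Fin 2 → L} (hx : (g : PlaneEnd).evalAt x = x)
    (c : L) :
    (Matrix.scalar (Fin 2) c - (g : PlaneEnd).jacobianAt x).det =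
      (c - algebraMap ℂ L a) * (c - algebraMap ℂ L b) := by
  obtain ⟨h, rfl⟩ := isConj_iff.1 (show IsConj f g from hg)
  set g := h * f * h⁻¹ with hgdef
  -- Differentiating this intertwining relation at the fixed point `x` gives the similarity, with
  -- `M` as change of basis.
  have hcomm : ((h⁻¹ : PlaneAut) : PlaneEnd) * g = (diag a b) * ((h⁻¹ : PlaneAut) : PlaneEnd) := by
    rw [← hf, ← Units.val_mul, ← Units.val_mul, hgdef]
    congr 1
    group
  set M := ((h⁻¹ : PlaneAut) : PlaneEnd).jacobianAt x with hM
  have hJ : M * (g : PlaneEnd).jacobianAt x =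
      Matrix.diagonal ![algebraMap ℂ L a, algebraMap ℂ L b] * M := by
    have := congrArg (fun e => e.jacobianAt x) hcomm
    simpa only [jacobianAt_mul, hx, jacobianAt_diag] using this
  have hMunit : IsUnit M.det := by
    have h1 : (h : PlaneEnd) * ((h⁻¹ : PlaneAut) : PlaneEnd) = 1 := h.mul_inv
    have := congrArg (fun e => (e.jacobianAt x).det) h1
    simp only [jacobianAt_mul, jacobianAt_one, Matrix.det_mul, Matrix.det_one] at this
    exact IsUnit.of_mul_eq_one_right _ this
  have hdet : M * (Matrix.scalar (Fin 2) c - (g : PlaneEnd).jacobianAt x) =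
      (Matrix.scalar (Fin 2) c - Matrix.diagonal ![algebraMap ℂ L a, algebraMap ℂ L b]) * M := by
    rw [mul_sub, sub_mul, hJ, (Matrix.scalar_commute c (fun r => Commute.all c r) M).eq]
  have := congrArg Matrix.det hdet
  rw [Matrix.det_mul, Matrix.det_mul, mul_comm] at this
  rw [hMunit.mul_right_cancel this]
  simp

end PlaneEnd

end ChainRule

/-! ### The generic endomorphism and its specializations -/

section Generic

open MvPolynomial

namespace PlaneEndLE

/-- The coordinates of the generic endomorphism of degree at most `m`. -/
def genericCoord (m : ℕ) (i : Fin 2) :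
    MvPolynomial (Fin 2) (MvPolynomial (Fin 2 × (Fin 2 →₀ ℕ)) ℂ) :=
  ∑ s ∈ Finset.Iic (Finsupp.equivFunOnFinite.symm fun _ => m), monomial s (X (i, s))

lemma map_genericCoord {m : ℕ} (g : PlaneEndLE m) (i : Fin 2) :
    map (eval g.coeffs) (genericCoord m i) = g.1.coord i := by
  ext s
  have hdeg : (g.1.coord i).totalDegree ≤ m := by
    have h := max_le_iff.1 (show max _ _ ≤ m from g.2)
    fin_cases i
    exacts [h.1, h.2]
  simp only [genericCoord, map_sum, map_monomial, coeff_sum, coeff_monomial, eval_X]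
  rw [Finset.sum_ite_eq' (Finset.Iic _) s (fun s => g.coeffs (i, s))]
  split_ifs with hs
  · rfl
  -- The box of exponents contains all those of degree at most `m`, so outside it the coefficients
  -- of `g` vanish.
  · by_contra hne
    refine hs (Finset.mem_Iic.2 fun k => ?_)
    have h1 : s.degree ≤ m := (le_totalDegree (mem_support_iff.2 (Ne.symm hne))).trans hdeg
    exact (Finsupp.le_degree k s).trans h1

/-- The equations of the fixed points of the generic endomorphism. -/
def fixedPointEq (m : ℕ) (i : Fin 2) :
    MvPolynomial (Fin 2) (MvPolynomial (Fin 2 × (Fin 2 →₀ ℕ)) ℂ) :=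
  genericCoord m i - X i

/-- The difference between the characteristic polynomial at `c` of the Jacobian matrix of the
generic endomorphism and the number `d`. -/
def genericCharpolySub (m : ℕ) (c d : ℂ) :
    MvPolynomial (Fin 2) (MvPolynomial (Fin 2 × (Fin 2 →₀ ℕ)) ℂ) :=
  (Matrix.scalar (Fin 2) (C (C c)) - jacobianMatrix (genericCoord m)).det - C (C d)

variable {L : Type*} [CommRing L] [Algebra ℂ L] {m : ℕ} (g : PlaneEndLE m) (y : Fin 2 → L)

/-- Specialization of the generic endomorphism to `g`, and of its argument to `y`. -/
def specialize : MvPolynomial (Fin 2) (MvPolynomial (Fin 2 × (Fin 2 →₀ ℕ)) ℂ) →+* L :=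
  eval₂Hom ((algebraMap ℂ L).comp (eval g.coeffs)) y

lemma specialize_apply (p) : specialize g y p = aeval y (map (eval g.coeffs) p) :=
  (eval₂_map _ _ _ _).symm

lemma specialize_C_C (c : ℂ) : specialize g y (C (C c)) = algebraMap ℂ L c := by
  simp [specialize]

lemma specialize_fixedPointEq (i : Fin 2) :
    specialize g y (fixedPointEq m i) = g.1.evalAt y i - y i := by
  rw [specialize_apply, fixedPointEq, map_sub, map_genericCoord, map_sub, map_X, aeval_X]
  rfl

lemma specialize_jacobianMatrix :
    (specialize g y).mapMatrix (jacobianMatrix (genericCoord m)) = g.1.jacobianAt y := by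
  refine Matrix.ext fun i j => ?_
  change specialize g y (pderiv j (genericCoord m i)) = aeval y (pderiv j (g.1.coord i))
  rw [specialize_apply, ← pderiv_map, map_genericCoord]

lemma specialize_genericCharpolySub (c d : ℂ) :
    specialize g y (genericCharpolySub m c d) =
      (Matrix.scalar (Fin 2) (algebraMap ℂ L c) - g.1.jacobianAt y).det - algebraMap ℂ L d := by
  rw [genericCharpolySub, map_sub, specialize_C_C, RingHom.map_det, map_sub,
    specialize_jacobianMatrix]
  congr 3
  refine Matrix.ext fun i j => ?_
  by_cases h : i = j <;> simp [h, specialize_C_C]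

lemma specialize_det_fixedPointEq :
    specialize g y (jacobianMatrix (fixedPointEq m)).det = (g.1.jacobianAt y - 1).det := by
  have : jacobianMatrix (fixedPointEq m) = jacobianMatrix (genericCoord m) - 1 := by
    refine Matrix.ext fun i j => ?_
    change pderiv j (genericCoord m i - X i) = pderiv j (genericCoord m i) - _
    rw [map_sub, pderiv_X, Matrix.one_apply]
    by_cases h : i = j <;> simp [h]
  rw [this, RingHom.map_det, map_sub, specialize_jacobianMatrix, map_one]

end PlaneEndLE

end Generic

/-! ### Passing to the Zariski closure -/

section Closure

open PlaneEnd PlaneEndLE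

lemma exists_eval_coeffs_ne_zero_of_mem_closure {m : ℕ} {S : Set (PlaneEndLE m)} {γ : PlaneEndLE m}
    (hγ : γ ∈ closure S) {P : MvPolynomial (Fin 2 × (Fin 2 →₀ ℕ)) ℂ}
    (hP : MvPolynomial.eval γ.coeffs P ≠ 0) : ∃ g ∈ S, MvPolynomial.eval g.coeffs P ≠ 0 := by
  by_contra! h
  have hclosed : IsClosed (zeroLocus m {P}) :=
    isOpen_compl_iff.1 ⟨{P}, (compl_compl _).symm⟩
  exact hP (closure_minimal (t := zeroLocus m {P}) (fun g hg Q hQ => hQ ▸ h g hg) hclosed hγ P rfl)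

/-- If `(α X, β Y)` is a limit of conjugates of `(a X, b Y)` and the fixed point `0` is
nondegenerate, then `diag(α, β)` and `diag(a, b)` have the same characteristic polynomial: otherwise
some conjugate has a fixed point, possibly over an extension ring of `ℂ`, at which its Jacobian
matrix has a different characteristic polynomial from `diag(a, b)`. -/
lemma charpoly_eq_of_mem_closure {a b α β : ℂ} {f : PlaneAut} (hf : (f : PlaneEnd) = diag a b)
    {m : ℕ} {γ : PlaneEndLE m} (hγ : γ.1 = diag α β) (hmem : γ ∈ closure (conjClassLE f m))
    (hα : α ≠ 1) (hβ : β ≠ 1) (c : ℂ) : (c - α) * (c - β) = (c - a) * (c - b) := by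
  by_contra hne
  -- Nonvanishing of the first factor means that the fixed point is nondegenerate, of the second
  -- that the characteristic polynomial at `c` is not that of `diag(a, b)`.
  let Q := (jacobianMatrix (fixedPointEq m)).det * genericCharpolySub m c ((c - a) * (c - b))
  have hF (i : Fin 2) : specialize γ (0 : Fin 2 → ℂ) (fixedPointEq m i) = 0 := by
    rw [specialize_fixedPointEq, hγ]
    fin_cases i <;> simp [evalAt, diag]
  have hQ : specialize γ (0 : Fin 2 → ℂ) Q ≠ 0 := by
    rw [map_mul, specialize_det_fixedPointEq, specialize_genericCharpolySub, hγ, jacobianAt_diag]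
    refine mul_ne_zero ?_ ?_
    · simp [Matrix.det_fin_two, sub_eq_zero, hα, hβ]
    · simpa [Matrix.det_fin_two, sub_eq_zero] using hne
  obtain ⟨P, hP, hPall⟩ := exists_nhds_forall_exists_zero (fixedPointEq m) Q (dvd_mul_right _ _)
    ((algebraMap ℂ ℂ).comp (MvPolynomial.eval γ.coeffs)) 0 hF hQ
  obtain ⟨g, ⟨h, hh, hhg⟩, hgP⟩ := exists_eval_coeffs_ne_zero_of_mem_closure hmem hP
  obtain ⟨L, _, _, y, hy, hyQ⟩ := hPall (MvPolynomial.eval g.coeffs)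
    (fun z => ⟨MvPolynomial.C z, MvPolynomial.eval_C z⟩) hgP
  have hfix : (h : PlaneEnd).evalAt y = y := by
    rw [hhg]
    exact funext fun i => sub_eq_zero.1 ((specialize_fixedPointEq g y i).symm.trans (hy i))
  refine hyQ (?_ : specialize g y Q = 0)
  rw [map_mul, specialize_genericCharpolySub, ← hhg, det_sub_jacobianAt_of_conj hf hh hfix]
  simp

end Closure

end

theorem lemma3p2 (a b α β : ℂ) (f : PlaneAut) (hf : (f : PlaneEnd) = PlaneEnd.diag a b) (m : ℕ)
    (γ : PlaneEndLE m) (hγ : γ.1 = PlaneEnd.diag α β)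
    (hmem : γ ∈ closure (conjClassLE f m)) (hα : α ≠ 1) (hβ : β ≠ 1) :
    ({α, β} : Set ℂ) = {a, b} := by
  have key := charpoly_eq_of_mem_closure hf hγ hmem hα hβ
  ext c
  simp only [Set.mem_insert_iff, Set.mem_singleton_iff]
  -- Each set is the zero set of the corresponding characteristic polynomial.
  rw [← sub_eq_zero (b := α), ← sub_eq_zero (b := β), ← mul_eq_zero, key c, mul_eq_zero,
    sub_eq_zero, sub_eq_zero]
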